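/- For every integer $d > 4$, the generic plane curve of degree $d$ contains a star configuration $\mathbb{X}(5)$. That is: let $S_d$ be the space of forms of degree $d$ in $\mathbb{C}[x,y,z]$ and let $\mathbb{P}S_d$ be the projective space parametrizing plane curves of degree $d$ in $\mathbb{P}^2=\mathbb{P}^2_{\mathbb{C}}$. Then for every integer $d > 4$ there is a nonempty Zariski open subset $U \subseteq \mathbb{P}S_d$ such that for every curve $\mathcal{C} \in U$ there exist five distinct lines $\ell_1,\dots,\ell_5 \subset \mathbb{P}^2$, no three of them passing through the same point, such that the ten points of $\mathbb{X}(5)=\{\ell_i\cap\ell_j : 1\le i<j\le 5\}$ all lie on $\mathcal{C}$. -/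

import Mathlib

open MvPolynomial

/-- The complex projective plane `ℙ²`. -/
abbrev ProjPlane : Type := Projectivization ℂ (Fin 3 → ℂ)

/-- The plane curves of degree `d`: the points of the projective space `ℙ S_d`, where `S_d` is the
space of forms of degree `d` in `S = ℂ[x, y, z]`, so that a curve is a nonzero form of degree `d`
up to a nonzero scalar (possibly reducible or nonreduced). -/
abbrev PlaneCurve (d : ℕ) : Type := Projectivization ℂ (homogeneousSubmodule (Fin 3) ℂ d)

/-- A chosen equation of a plane curve (it is unique up to a nonzero scalar). -/
noncomputable def PlaneCurve.equation {d : ℕ} (C : PlaneCurve d) : MvPolynomial (Fin 3) ℂ :=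
  (C.rep : homogeneousSubmodule (Fin 3) ℂ d).1

/-- The set of points of `ℙ²` lying on a plane curve. As the equation is homogeneous, neither the
choice of the equation nor that of the homogeneous coordinates matters, see
`PlaneCurve.mk_mem_points_iff`. -/
def PlaneCurve.points {d : ℕ} (C : PlaneCurve d) : Set ProjPlane :=
  {p | eval p.rep C.equation = 0}

theorem PlaneCurve.mk_mem_points_iff {d : ℕ} (F : homogeneousSubmodule (Fin 3) ℂ d) (hF : F ≠ 0)
    (v : Fin 3 → ℂ) (hv : v ≠ 0) :
    Projectivization.mk ℂ v hv ∈ PlaneCurve.points (Projectivization.mk ℂ F hF) ↔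
      eval v F.1 = 0 := by
  obtain ⟨a, ha⟩ := Projectivization.exists_smul_eq_mk_rep ℂ F hF
  obtain ⟨b, hb⟩ := Projectivization.exists_smul_eq_mk_rep ℂ v hv
  have hF' : F.1.IsHomogeneous d := (mem_homogeneousSubmodule d F.1).1 F.2
  have h2 : eval ((b : ℂ) • v) F.1 = (b : ℂ) ^ d * eval v F.1 := by
    rw [eval_eq', eval_eq', Finset.mul_sum]
    refine Finset.sum_congr rfl fun m hm => ?_
    have hm' : ∑ i, m i = d := by
      have := hF' (mem_support_iff.1 hm)
      simpa [Finsupp.weight_apply, Finsupp.sum_fintype] using this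
    simp only [Pi.smul_apply, smul_eq_mul, mul_pow, Finset.prod_mul_distrib,
      Finset.prod_pow_eq_pow_sum, hm']
    ring
  simp only [PlaneCurve.points, PlaneCurve.equation, Set.mem_ofPred_eq, ← ha, ← hb]
  simp only [Units.smul_def, Submodule.coe_smul, smul_eval, h2]
  simp

/-- The index set of the standard monomial basis of `S_d`: the exponents of the monomials of
degree `d` in three variables. -/
abbrev MonomialIndex (d : ℕ) : Type := {m : Fin 3 →₀ ℕ // m.degree = d}

/-- Homogeneous coordinates, with respect to the standard monomial basis, of a plane curve as a
point of `ℙ S_d`. -/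
noncomputable def PlaneCurve.coords {d : ℕ} (C : PlaneCurve d) : MonomialIndex d → ℂ :=
  fun m => coeff m.1 C.equation

/-- Zariski closed subsets of `ℙ S_d`: the common zero loci of sets of homogeneous polynomials in
the homogeneous coordinates. -/
def IsZariskiClosed {d : ℕ} (Z : Set (PlaneCurve d)) : Prop :=
  ∃ T : Set (MvPolynomial (MonomialIndex d) ℂ),
    (∀ G ∈ T, ∃ n : ℕ, G.IsHomogeneous n) ∧ Z = {C | ∀ G ∈ T, eval C.coords G = 0}

/-- Zariski open subsets of `ℙ S_d`. -/
def IsZariskiOpen {d : ℕ} (U : Set (PlaneCurve d)) : Prop :=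
  IsZariskiClosed Uᶜ

/-- The generic plane curve of degree `d` has the property `P`: all curves in some nonempty Zariski
open subset of the irreducible variety `ℙ S_d` have it. -/
def GenericPlaneCurve (d : ℕ) (P : PlaneCurve d → Prop) : Prop :=
  ∃ U : Set (PlaneCurve d), IsZariskiOpen U ∧ U.Nonempty ∧ ∀ C ∈ U, P C

/-- `X` is a star configuration `𝕏(l)`, `l ≥ 2`: the set of the pairwise intersection points of `l`
distinct lines (plane curves of degree one), no three of which pass through the same point. (The
`l.choose 2` intersection points are then automatically distinct.) -/
def IsStarConfiguration (l : ℕ) (X : Set ProjPlane) : Prop :=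
  ∃ L : Fin l → PlaneCurve 1,
    Function.Injective L ∧
    (∀ i j k : Fin l, i ≠ j → i ≠ k → j ≠ k →
      (L i).points ∩ (L j).points ∩ (L k).points = ∅) ∧
    X = {p | ∃ i j : Fin l, i < j ∧ p ∈ (L i).points ∩ (L j).points}

/-!
If `l 0, …, l 4` are linear forms, every form `F = ∑ i, g i * ∏ j ≠ i, l j` vanishes at the
intersection points of the lines `l i`. So the curves of degree `d = k + 5` that contain a star
configuration `𝕏(5)` include the image, over the open set where no three lines are concurrent, of
the polynomial map sending the coefficients of the `l i` and of the forms `g i` of degree `k + 1`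
to those of `F`. The theorem holds because this map is dominant.

It suffices that its differential is surjective at one point
(`aeval_injective_of_surjective_differential`); then Chevalley's theorem and the Nullstellensatz
give a nonempty open subset of the image (`exists_ne_zero_forall_mem_range`), which may be replaced
by an open cone as the image is invariant under scaling (`exists_isHomogeneous_eval_ne_zero`).

The point consists of the lines `x + a y + a² z`, for five values of `a`, and of `g i = z ^ k * h i`
with fixed linear forms `h i`. The image of the differential contains the forms of degree `k + 5` in
the ideal `J` generated by the products of four of the lines. As `z = 0` contains none of the ten
points, every form of degree at least `4` is, modulo `J`, a multiple of `z`
(`homogeneousSubmodule_four_le`). This reduces the surjectivity in all degrees to that for quintics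
(`le_sup_pow_mul`), and there to the multiples of `z ^ 2`, where it is a finite computation
(`X_two_sq_mul_cubic_mem`).
-/

/-! ### Dominant polynomial maps -/

theorem aeval_mul_of_isHomogeneous {σ R A : Type*} [CommSemiring R] [CommSemiring A] [Algebra R A]
    {P : MvPolynomial σ R} {n : ℕ} (hP : P.IsHomogeneous n) (t : A) (u : σ → A) :
    aeval (fun s => t * u s) P = t ^ n * aeval u P := by
  rw [aeval_def, aeval_def, eval₂_eq, eval₂_eq, Finset.mul_sum]
  refine Finset.sum_congr rfl fun m hm => ?_
  have hm' : ∑ i ∈ m.support, m i = n := (hP.degree_eq_sum_deg_support hm).symm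
  simp only [mul_pow, Finset.prod_mul_distrib, Finset.prod_pow_eq_pow_sum, hm']
  ring

/-- A polynomial map `f` between affine spaces whose differential at one point `p` is surjective is
dominant, that is, `aeval f` is injective. The hypothesis states that every tangent vector `w` at
`x₀ = f(p)` is the velocity of the image of some line through `p`, as a congruence modulo `X ^ 2`
in `ℂ[X]`. If `P(f) = 0` with `P ≠ 0`, restricting to such a line shows that the lowest homogeneous
part of the Taylor expansion of `P` at `x₀` vanishes at every `w`. -/
theorem aeval_injective_of_surjective_differential {σ τ : Type*}
    (f : σ → MvPolynomial τ ℂ) (p : τ → ℂ) (x₀ : σ → ℂ)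
    (h : ∀ w : σ → ℂ, ∃ v : τ → ℂ, ∀ s, ∃ r : Polynomial ℂ,
      aeval (fun t => Polynomial.C (p t) + Polynomial.X * Polynomial.C (v t)) (f s) =
        Polynomial.C (x₀ s) + Polynomial.X * Polynomial.C (w s) + Polynomial.X ^ 2 * r) :
    Function.Injective (aeval f : MvPolynomial σ ℂ →ₐ[ℂ] MvPolynomial τ ℂ) := by
  rw [injective_iff_map_eq_zero]
  intro P hP
  by_contra hP0
  -- the Taylor expansion of `P` at `x₀`
  set Q : MvPolynomial σ ℂ := aeval (fun s => X s + C (x₀ s)) P with hQ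
  have hQ0 : Q ≠ 0 := by
    intro h0
    apply hP0
    have : aeval (fun s => X s - C (x₀ s)) Q = P := by
      rw [hQ, ← AlgHom.comp_apply, comp_aeval]
      simp [← algebraMap_eq]
    rw [← this, h0, map_zero]
  have hex : ∃ n, homogeneousComponent n Q ≠ 0 := by
    by_contra! hall
    exact hQ0 (by rw [← sum_homogeneousComponent Q]; simp [hall])
  classical
  let n := Nat.find hex
  have hn : homogeneousComponent n Q ≠ 0 := Nat.find_spec hex
  have hlt : ∀ k < n, homogeneousComponent k Q = 0 := fun k hk => by
    simpa using Nat.find_min hex hk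
  obtain ⟨w, hw⟩ : ∃ w, eval w (homogeneousComponent n Q) ≠ 0 := by
    by_contra! hall
    exact hn (MvPolynomial.funext fun w => by simp [hall w])
  obtain ⟨v, hv⟩ := h w
  choose r hr using hv
  let u : σ → Polynomial ℂ := fun s => Polynomial.C (w s) + Polynomial.X * r s
  -- along the line through `p` with velocity `v`, the map `f - x₀` is `X * u`
  have h0 : aeval (fun s => Polynomial.X * u s) Q = 0 := by
    have h1 : aeval (fun t => Polynomial.C (p t) + Polynomial.X * Polynomial.C (v t))
        (aeval f P) = 0 := by rw [hP, map_zero]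
    rw [← AlgHom.comp_apply, comp_aeval] at h1
    rw [hQ, ← AlgHom.comp_apply, comp_aeval, ← h1]
    congr 2
    funext s
    rw [hr s]
    simp only [map_add, aeval_X, aeval_C, Polynomial.algebraMap_eq, u]
    ring
  -- the components of `Q` of degree below `n` vanish and those above it contribute multiples of
  -- `X ^ (n + 1)`, so only the component of degree `n` survives
  have hdvd : (Polynomial.X : Polynomial ℂ) ^ (n + 1) ∣
      Polynomial.X ^ n * aeval u (homogeneousComponent n Q) := by
    have hsum : ∑ k ∈ Finset.range (Q.totalDegree + 1),
        Polynomial.X ^ k * aeval u (homogeneousComponent k Q) = 0 := by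
      rw [← h0]
      conv_rhs => rw [← sum_homogeneousComponent Q, map_sum]
      exact Finset.sum_congr rfl fun k _ =>
        (aeval_mul_of_isHomogeneous (homogeneousComponent_isHomogeneous k Q) _ _).symm
    have hmem : n ∈ Finset.range (Q.totalDegree + 1) := by
      by_contra hnot
      exact hn (homogeneousComponent_eq_zero _ _ (by simpa using hnot))
    rw [← Finset.add_sum_erase _ _ hmem, add_eq_zero_iff_eq_neg] at hsum
    rw [hsum, dvd_neg]
    refine Finset.dvd_sum fun k hk => ?_
    rcases lt_or_gt_of_ne (Finset.ne_of_mem_erase hk) with hlt' | hgt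
    · simp [hlt k hlt']
    · exact (pow_dvd_pow _ hgt).mul_right _
  rw [pow_succ, mul_dvd_mul_iff_left (pow_ne_zero _ Polynomial.X_ne_zero),
    Polynomial.X_dvd_iff, Polynomial.coeff_zero_eq_eval_zero] at hdvd
  apply hw
  rw [← hdvd, ← Polynomial.coe_evalRingHom, aeval_def, Polynomial.algebraMap_eq, hom_eval₂,
    eval₂_eq, eval_eq]
  simp [u]

/-- A dominant polynomial map `f` sends the open set `b ≠ 0` onto a set containing a nonempty open
set `a ≠ 0`. By Chevalley's theorem the image on prime spectra is constructible; it contains the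
generic point, hence a nonempty basic open set, and by the Nullstellensatz the fibres over the
closed points of the latter contain closed points with `b ≠ 0`. -/
theorem exists_ne_zero_forall_mem_range {σ τ : Type*} [Finite σ] [Finite τ]
    (f : σ → MvPolynomial τ ℂ)
    (hf : Function.Injective (aeval f : MvPolynomial σ ℂ →ₐ[ℂ] MvPolynomial τ ℂ))
    {b : MvPolynomial τ ℂ} (hb : b ≠ 0) :
    ∃ a : MvPolynomial σ ℂ, a ≠ 0 ∧ ∀ x, eval x a ≠ 0 →
      ∃ q, eval q b ≠ 0 ∧ ∀ s, eval q (f s) = x s := by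
  let φ : MvPolynomial σ ℂ →+* MvPolynomial τ ℂ := (aeval f).toRingHom
  have hfp : φ.FinitePresentation := by
    apply RingHom.FinitePresentation.of_finiteType.1
    have : (φ.comp C).FiniteType := by
      have : φ.comp C = C := by ext1 x; simp [φ]
      rw [this]
      exact RingHom.finiteType_algebraMap.2 inferInstance
    exact this.of_comp_finiteType
  have hcons := PrimeSpectrum.isConstructible_comap_image hfp
    (PrimeSpectrum.isConstructible_basicOpen (f := b))
  obtain ⟨D, hD⟩ := PrimeSpectrum.exists_constructibleSetData_iff.2 hcons
  have hgen : (⊥ : PrimeSpectrum (MvPolynomial σ ℂ)) ∈ D.toSet := by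
    rw [hD]
    refine ⟨⊥, ?_, ?_⟩
    · simpa using hb
    · ext1
      exact (RingHom.ker_eq_bot_iff_eq_zero φ).2 (fun x hx => hf (by simpa [φ] using hx))
  simp only [PrimeSpectrum.ConstructibleSetData.toSet, Set.mem_iUnion] at hgen
  obtain ⟨c, hc, hgen⟩ := hgen
  obtain ⟨hg, ha⟩ := hgen
  -- the piece `V(g) \ V(f)` containing the generic point has `g = 0`, so it is the open set `f ≠ 0`
  have hg0 : ∀ i, c.g i = 0 := fun i => by
    simpa using hg (Set.mem_range_self i)
  refine ⟨c.f, by simpa [PrimeSpectrum.mem_zeroLocus] using ha, fun x hx => ?_⟩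
  let 𝔪 : PrimeSpectrum (MvPolynomial σ ℂ) := ⟨RingHom.ker (eval x), RingHom.ker_isPrime _⟩
  have hmem : 𝔪 ∈ D.toSet := by
    simp only [PrimeSpectrum.ConstructibleSetData.toSet, Set.mem_iUnion]
    refine ⟨c, hc, ?_, ?_⟩
    · rintro _ ⟨i, rfl⟩
      simp [hg0 i]
    · simpa [PrimeSpectrum.mem_zeroLocus, 𝔪, RingHom.mem_ker] using hx
  rw [hD] at hmem
  obtain ⟨P, hbP, hP⟩ := hmem
  have hvan := IsPrime.vanishingIdeal_zeroLocus (K := ℂ) P.asIdeal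
  have hbP' : b ∉ vanishingIdeal ℂ (zeroLocus ℂ P.asIdeal) := by rwa [hvan]
  simp only [mem_vanishingIdeal_iff, not_forall] at hbP'
  obtain ⟨q, hq, hbq⟩ := hbP'
  refine ⟨q, by simpa [coe_aeval_eq_eval] using hbq, fun s => ?_⟩
  have hs : X s - C (x s) ∈ 𝔪.asIdeal := by simp [𝔪, RingHom.mem_ker]
  rw [← hP] at hs
  have hs' : φ (X s - C (x s)) ∈ P.asIdeal := hs
  have := hq _ hs'
  simpa [φ, coe_aeval_eq_eval, sub_eq_zero] using this

/-! ### The form attached to five lines and five multipliers -/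

/-- For linear forms `l 0, …, l 4`, the product of all of them but `l i`. -/
def cofactor {R : Type*} [CommRing R] (l : Fin 5 → R) (i : Fin 5) : R :=
  ∏ j with j ≠ i, l j

/-- The element `∑ i, g i * ∏ j ≠ i, l j` of the ideal of the star configuration cut out by the
lines `l i`. -/
def starForm {R : Type*} [CommRing R] (l g : Fin 5 → R) : R :=
  ∑ i, g i * cofactor l i

/-- The partial derivative of `starForm l g` with respect to `l i`. -/
def starFormPartial {R : Type*} [CommRing R] (l g : Fin 5 → R) (i : Fin 5) : R :=
  ∑ j with j ≠ i, g j * ∏ k with k ≠ i ∧ k ≠ j, l k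

/-- First order expansion of `starForm` in all its arguments. -/
theorem exists_starForm_add_mul {R : Type*} [CommRing R] (t : R) (l g l' g' : Fin 5 → R) :
    ∃ r, starForm (fun i => l i + t * l' i) (fun i => g i + t * g' i) =
      starForm l g + t * (∑ i, g' i * cofactor l i + ∑ i, l' i * starFormPartial l g i) +
        t ^ 2 * r := by
  have hmul : ∀ {a a₀ a₁ b b₀ b₁ : R}, (∃ r, a = a₀ + t * a₁ + t ^ 2 * r) →
      (∃ r, b = b₀ + t * b₁ + t ^ 2 * r) →
      ∃ r, a * b = a₀ * b₀ + t * (a₀ * b₁ + a₁ * b₀) + t ^ 2 * r := by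
    rintro a a₀ a₁ b b₀ b₁ ⟨r, rfl⟩ ⟨s, rfl⟩
    exact ⟨a₁ * b₁ + r * (b₀ + t * b₁ + t ^ 2 * s) + (a₀ + t * a₁) * s, by ring⟩
  have hlin : ∀ a b : R, ∃ r, a + t * b = a + t * b + t ^ 2 * r := fun a b => ⟨0, by ring⟩
  have hterm : ∀ i j k m n : Fin 5, ∃ r, (g i + t * g' i) *
      ((l j + t * l' j) * (l k + t * l' k) * (l m + t * l' m) * (l n + t * l' n)) =
      g i * (l j * l k * l m * l n) + t * (g' i * (l j * l k * l m * l n) + g i *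
        (l' j * (l k * l m * l n) + l' k * (l j * l m * l n) + l' m * (l j * l k * l n) +
          l' n * (l j * l k * l m))) + t ^ 2 * r := by
    intro i j k m n
    obtain ⟨r, hr⟩ := hmul (hlin (g i) (g' i)) (hmul (hmul (hmul (hlin (l j) (l' j))
      (hlin (l k) (l' k))) (hlin (l m) (l' m))) (hlin (l n) (l' n)))
    exact ⟨r, by rw [hr]; ring⟩
  obtain ⟨r₀, h₀⟩ := hterm 0 1 2 3 4
  obtain ⟨r₁, h₁⟩ := hterm 1 0 2 3 4
  obtain ⟨r₂, h₂⟩ := hterm 2 0 1 3 4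
  obtain ⟨r₃, h₃⟩ := hterm 3 0 1 2 4
  obtain ⟨r₄, h₄⟩ := hterm 4 0 1 2 3
  refine ⟨r₀ + r₁ + r₂ + r₃ + r₄, ?_⟩
  simp [starForm, starFormPartial, cofactor, Finset.prod_filter, Finset.sum_filter,
    Fin.prod_univ_five, Fin.sum_univ_five]
  linear_combination h₀ + h₁ + h₂ + h₃ + h₄

/-! ### The tangent space at an explicit star configuration -/

/-- The five lines `x + a y + a² z` with `a = 0, 1, -1, 2, -2`: tangents to a conic, so that no
three of them are concurrent (a Vandermonde determinant), with distinct intersections with the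
line `z = 0`. -/
noncomputable def baseLine : Fin 5 → MvPolynomial (Fin 3) ℂ :=
  ![X 0, X 0 + X 1 + X 2, X 0 - X 1 + X 2, X 0 + 2 * X 1 + 4 * X 2, X 0 - 2 * X 1 + 4 * X 2]

/-- Linear multipliers such that the parametrization of quintics by `starForm` is submersive at
`starForm baseLine baseMultiplier`. For special multipliers this fails, for instance when they are
all equal to `z`. -/
noncomputable def baseMultiplier : Fin 5 → MvPolynomial (Fin 3) ℂ :=
  ![X 1, X 1, X 2, X 0, X 0]

-- `𝒮 n` is the space of ternary forms of degree `n`, `𝒥` the degree four part of the ideal of the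
-- star configuration, `𝒲` the span of the partial derivatives of `starForm` with respect to the
-- lines for the multipliers `baseMultiplier`, and `𝒵` the span of `z`.
local notation "𝒮" => homogeneousSubmodule (Fin 3) ℂ
local notation "𝒥" => Submodule.span ℂ (Set.range (cofactor baseLine))
local notation "𝒲" => Submodule.span ℂ (Set.range (starFormPartial baseLine baseMultiplier))
local notation "𝒵" => Submodule.span ℂ ({X 2} : Set (MvPolynomial (Fin 3) ℂ))

theorem homogeneousSubmodule_mul_eq {m n r : ℕ} (h : m + n = r) : 𝒮 m * 𝒮 n = 𝒮 r := by
  have hpow := homogeneousSubmodule_one_pow (σ := Fin 3) (R := ℂ)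
  rw [← hpow m, ← hpow n, ← hpow r, ← pow_add, h]

theorem homogeneousSubmodule_le_of_monomials {n : ℕ}
    {M : Submodule ℂ (MvPolynomial (Fin 3) ℂ)}
    (h : ∀ a b c, a + b + c = n → X 0 ^ a * X 1 ^ b * X 2 ^ c ∈ M) : 𝒮 n ≤ M := by
  intro F hF
  rw [F.as_sum]
  refine Submodule.sum_mem _ fun m hm => ?_
  have hm' := hF (mem_support_iff.1 hm)
  have hdeg : m 0 + m 1 + m 2 = n := by
    rw [← hm']
    simp [Finsupp.weight_apply, Finsupp.sum_fintype, Fin.sum_univ_three]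
  rw [monomial_eq, ← smul_eq_C_mul, Finsupp.prod_fintype _ _ (by simp), Fin.prod_univ_three]
  exact M.smul_mem _ (h _ _ _ hdeg)

theorem X_mem_homogeneousSubmodule (i : Fin 3) : X i ∈ 𝒮 1 := isHomogeneous_X _ _

theorem sum_mem_homogeneousSubmodule_one (c : Fin 3 → ℤ) :
    ∑ k, (c k : MvPolynomial (Fin 3) ℂ) * X k ∈ 𝒮 1 := by
  refine Submodule.sum_mem _ fun k _ => ?_
  rw [← zsmul_eq_mul]
  exact zsmul_mem (X_mem_homogeneousSubmodule k) _

theorem mem_of_nat_mul_mem {M : Submodule ℂ (MvPolynomial (Fin 3) ℂ)} {F : MvPolynomial (Fin 3) ℂ}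
    (N : ℕ) (hN : N ≠ 0) (h : (N : MvPolynomial (Fin 3) ℂ) * F ∈ M) : F ∈ M := by
  have : (N : MvPolynomial (Fin 3) ℂ) * F = (N : ℂ) • F := by
    rw [smul_eq_C_mul, map_natCast]
  rw [this] at h
  exact (M.smul_mem_iff (by exact_mod_cast hN)).1 h

theorem monomial_mem_homogeneousSubmodule {n a b c : ℕ} (h : a + b + c = n) :
    (X 0 ^ a * X 1 ^ b * X 2 ^ c : MvPolynomial (Fin 3) ℂ) ∈ 𝒮 n := by
  have h0 := (isHomogeneous_X ℂ (0 : Fin 3)).pow a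
  have h1 := (isHomogeneous_X ℂ (1 : Fin 3)).pow b
  have h2 := (isHomogeneous_X ℂ (2 : Fin 3)).pow c
  have := (h0.mul h1).mul h2
  rw [one_mul, one_mul, one_mul, h] at this
  exact this

/-- Modulo `z`, the five products of four of the lines are a basis of the binary quartics, since the
lines meet `z = 0` in distinct points; the coefficients `u` below, over `N`, are those
of the Lagrange interpolation of `x ^ a * y ^ (4 - a)`. -/
theorem homogeneousSubmodule_four_le : 𝒮 4 ≤ 𝒥 ⊔ 𝒵 * 𝒮 3 := by
  have key : ∀ (F : MvPolynomial (Fin 3) ℂ) (N : ℕ) (u : Fin 5 → ℤ) (v : Fin 8 → ℤ), N ≠ 0 →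
      (N : MvPolynomial (Fin 3) ℂ) * F =
        ∑ i, (u i : MvPolynomial (Fin 3) ℂ) * cofactor baseLine i + X 2 *
          ∑ i, (v i : MvPolynomial (Fin 3) ℂ) * (X 0 ^ (![3, 2, 2, 1, 1, 1, 0, 0] i) *
            X 1 ^ (![0, 1, 0, 2, 1, 0, 2, 0] i) * X 2 ^ (![0, 0, 1, 0, 1, 2, 1, 3] i)) →
      F ∈ 𝒥 ⊔ 𝒵 * 𝒮 3 := by
    intro F N u v hN h
    refine mem_of_nat_mul_mem N hN ?_
    rw [h]
    refine add_mem (Submodule.mem_sup_left ?_) (Submodule.mem_sup_right ?_)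
    · refine Submodule.sum_mem _ fun i _ => ?_
      rw [← zsmul_eq_mul]
      exact zsmul_mem (Submodule.subset_span (Set.mem_range_self i)) _
    · refine Submodule.mul_mem_mul (Submodule.mem_span_singleton_self _)
        (Submodule.sum_mem _ fun i _ => ?_)
      rw [← zsmul_eq_mul]
      refine zsmul_mem (monomial_mem_homogeneousSubmodule ?_) _
      fin_cases i <;> rfl
  refine homogeneousSubmodule_le_of_monomials fun a b c h => ?_
  obtain _ | c := c
  · have ha : a ≤ 4 := by omega
    obtain rfl : b = 4 - a := by omega
    interval_cases a
    on_goal 1 =>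
      refine key _ 24 ![6, -4, -4, 1, 1] ![0, 0, -24, 72, 0, -120, 120, -96] (by norm_num) ?_
    on_goal 2 => refine key _ 12 ![0, 2, -2, -1, 1] ![0, 24, 0, 0, 60, 0, 0, 0] (by norm_num) ?_
    on_goal 3 => refine key _ 6 ![0, -1, -1, 1, 1] ![6, 0, 30, 0, 0, 24, 0, 0] (by norm_num) ?_
    on_goal 4 => refine key _ 6 ![0, 1, -1, -2, 2] ![0, 0, 0, 0, 24, 0, 0, 0] (by norm_num) ?_
    on_goal 5 => refine key _ 6 ![0, -1, -1, 4, 4] ![-30, 0, -24, 24, 0, 0, 0, 0] (by norm_num) ?_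
    all_goals
      simp [Fin.sum_univ_succ, baseLine, cofactor, Finset.prod_filter, Fin.prod_univ_five]
      ring
  · refine Submodule.mem_sup_right ?_
    have : (X 0 ^ a * X 1 ^ b * X 2 ^ (c + 1) : MvPolynomial (Fin 3) ℂ) =
        X 2 * (X 0 ^ a * X 1 ^ b * X 2 ^ c) := by ring
    rw [this]
    exact Submodule.mul_mem_mul (Submodule.mem_span_singleton_self _)
      (monomial_mem_homogeneousSubmodule (by omega))

/-- Membership of a quintic in the tangent space, from an explicit combination: the rows of `A` and
`B` are the coefficients of the linear forms multiplying the cofactors and the partial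
derivatives. -/
theorem mem_of_nat_mul_eq_sum {F : MvPolynomial (Fin 3) ℂ} {N : ℕ} (hN : N ≠ 0)
    (A B : Matrix (Fin 5) (Fin 3) ℤ)
    (h : (N : MvPolynomial (Fin 3) ℂ) * F =
      ∑ i, ((∑ k, (A i k : MvPolynomial (Fin 3) ℂ) * X k) * cofactor baseLine i +
        (∑ k, (B i k : MvPolynomial (Fin 3) ℂ) * X k) *
          starFormPartial baseLine baseMultiplier i)) :
    F ∈ 𝒮 1 * 𝒥 ⊔ 𝒮 1 * 𝒲 := by
  refine mem_of_nat_mul_mem N hN ?_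
  rw [h]
  refine Submodule.sum_mem _ fun i _ => add_mem (Submodule.mem_sup_left ?_)
    (Submodule.mem_sup_right ?_)
  · exact Submodule.mul_mem_mul (sum_mem_homogeneousSubmodule_one _)
      (Submodule.subset_span (Set.mem_range_self i))
  · exact Submodule.mul_mem_mul (sum_mem_homogeneousSubmodule_one _)
      (Submodule.subset_span (Set.mem_range_self i))

/-- The multiples of `z ^ 2` lie in the tangent space to the parametrization of quintics. The
certificates come from solving a linear system in each case. -/
theorem X_two_sq_mul_cubic_mem {a b : ℕ} (h : a + b ≤ 3) :
    (X 2 ^ 2 * (X 0 ^ a * X 1 ^ b * X 2 ^ (3 - a - b)) : MvPolynomial (Fin 3) ℂ) ∈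
      𝒮 1 * 𝒥 ⊔ 𝒮 1 * 𝒲 := by
  have ha : a ≤ 3 := by omega
  have hb : b ≤ 3 - a := by omega
  interval_cases a <;> interval_cases b
  on_goal 1 =>
    refine mem_of_nat_mul_eq_sum (N := 3456) (by norm_num)
      !![228, 63, 0; 0, -236, -269; 0, 60, 180; 0, 426, 0; 0, 74, -592]
      !![0, -63, 216; -39, 0, -423; -72, 0, -9; -207, 0, 72; 201, 0, -72] ?_
  on_goal 2 =>
    refine mem_of_nat_mul_eq_sum (N := 1728) (by norm_num)
      !![-144, 9, -42; 0, 0, 99; 34, -69, 0; 41, 0, 138; 0, 0, 186]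
      !![0, -24, 42; 0, -6, 0; 42, 0, 54; 66, 36, 0; -81, -6, -60] ?_
  on_goal 3 =>
    refine mem_of_nat_mul_eq_sum (N := 288) (by norm_num)
      !![0, 0, 15; 9, 0, 3; 0, -5, 0; -8, 0, -5; 0, 0, -17]
      !![-8, 15, -15; 0, -18, 0; 6, 0, 12; 0, -6, 12; 3, -12, 0] ?_
  on_goal 4 =>
    refine mem_of_nat_mul_eq_sum (N := 576) (by norm_num)
      !![-55, 0, -6; 0, 57, 9; -55, 0, 0; 90, 0, 266; 0, 0, 178]
      !![-38, -42, 6; 0, 24, 0; 60, 6, 54; 66, 48, 0; -90, 0, -96] ?_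
  on_goal 5 =>
    refine mem_of_nat_mul_eq_sum (N := 864) (by norm_num)
      !![0, -24, 66; 0, 77, 38; -6, 1, -94; 0, -136, -86; 0, 4, 10]
      !![0, 39, -66; 0, -9, 96; 0, 6, 21; 39, 0, 0; -33, 0, 0] ?_
  on_goal 6 =>
    refine mem_of_nat_mul_eq_sum (N := 864) (by norm_num)
      !![0, -18, -24; 0, 15, -45; 0, -5, 53; 0, 14, 16; 0, -66, 0]
      !![0, -6, 24; 0, 30, 0; 0, 6, -24; -24, 0, 0; 24, 0, 0] ?_
  on_goal 7 =>
    refine mem_of_nat_mul_eq_sum (N := 288) (by norm_num)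
      !![0, 0, 6; 15, -6, 30; 5, 0, 0; -20, 0, -90; 0, 0, -42]
      !![0, -12, -6; 0, 6, 0; 0, -6, 24; -12, 0, 0; 12, 0, 0] ?_
  on_goal 8 =>
    refine mem_of_nat_mul_eq_sum (N := 216) (by norm_num)
      !![0, 15, -15; 5, -9, 0; 0, -5, 32; 0, 20, 1; 1, 0, -3]
      !![0, -6, 15; 0, -3, -24; 0, 6, -15; -6, 0, 0; 0, 0, 0] ?_
  on_goal 9 =>
    refine mem_of_nat_mul_eq_sum (N := 432) (by norm_num)
      !![0, 36, 30; 0, -3, 27; 0, -5, -37; 0, -40, -2; 0, 60, -18]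
      !![0, -6, -30; 0, -24, 0; 0, 6, 30; 30, 0, 0; -30, 0, 0] ?_
  on_goal 10 =>
    refine mem_of_nat_mul_eq_sum (N := 216) (by norm_num)
      !![0, 0, 18; 0, -1, 5; 0, 15, -45; 0, 0, 18; 0, -8, -14]
      !![12, 0, -18; -6, 0, 18; -18, 0, 18; 0, 0, 0; 24, 0, 0] ?_
  all_goals
    simp [Fin.sum_univ_five, Fin.sum_univ_three, baseLine, baseMultiplier, cofactor,
      starFormPartial, Finset.prod_filter, Finset.sum_filter, Fin.prod_univ_five]
    ring

/-- The induction on the degree, for a family `S` of submodules behaving like the graded pieces of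
a polynomial ring: modulo multiples of `J`, degree `n + 4` consists of the multiples by `Z` of
degree `n + 3`, so that everything reduces to `Z * (Z * S 3)`. -/
theorem le_sup_pow_mul {R A : Type*} [CommSemiring R] [CommSemiring A] [Algebra R A]
    {S : ℕ → Submodule R A} {J W Z : Submodule R A} (hS : ∀ m n, S m * S n = S (m + n))
    (hZ : Z ≤ S 1) (h4 : S 4 ≤ J ⊔ Z * S 3) (h5 : Z * (Z * S 3) ≤ S 1 * J ⊔ S 1 * W) (k : ℕ) :
    S (k + 5) ≤ S (k + 1) * J ⊔ Z ^ k * (S 1 * W) := by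
  have hstep : ∀ n, S (n + 4) ≤ S n * J ⊔ Z * S (n + 3) := fun n =>
    calc S (n + 4) = S n * S 4 := (hS n 4).symm
      _ ≤ S n * (J ⊔ Z * S 3) := mul_le_mul' le_rfl h4
      _ = S n * J ⊔ Z * S (n + 3) := by rw [Submodule.mul_sup, mul_left_comm, hS]
  induction k with
  | zero =>
    have h4' : Z * S 4 ≤ S 1 * J ⊔ S 1 * W :=
      calc Z * S 4 ≤ Z * (J ⊔ Z * S 3) := mul_le_mul' le_rfl h4
        _ = Z * J ⊔ Z * (Z * S 3) := Submodule.mul_sup _ _ _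
        _ ≤ _ := sup_le ((mul_le_mul' hZ le_rfl).trans le_sup_left) h5
    simpa using (hstep 1).trans (sup_le le_sup_left h4')
  | succ k ih =>
    have hZS : Z * S (k + 5) ≤ S (k + 2) * J ⊔ Z ^ (k + 1) * (S 1 * W) :=
      calc Z * S (k + 5) ≤ Z * (S (k + 1) * J ⊔ Z ^ k * (S 1 * W)) := mul_le_mul' le_rfl ih
        _ = Z * S (k + 1) * J ⊔ Z ^ (k + 1) * (S 1 * W) := by
          rw [Submodule.mul_sup, ← mul_assoc, ← mul_assoc, ← pow_succ']
        _ ≤ S 1 * S (k + 1) * J ⊔ Z ^ (k + 1) * (S 1 * W) :=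
          sup_le_sup_right (mul_le_mul' (mul_le_mul' hZ le_rfl) le_rfl) _
        _ = _ := by rw [hS, show 1 + (k + 1) = k + 2 by omega]
    exact (hstep (k + 2)).trans (sup_le le_sup_left hZS)

theorem exists_sum_of_mem_mul_span_range {R A ι : Type*} [CommSemiring R] [CommSemiring A]
    [Algebra R A] [Fintype ι] {M : Submodule R A} {v : ι → A} {F : A}
    (hF : F ∈ M * Submodule.span R (Set.range v)) :
    ∃ g : ι → A, (∀ i, g i ∈ M) ∧ F = ∑ i, g i * v i := by
  refine Submodule.mul_induction_on hF (fun m hm n hn => ?_) ?_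
  · obtain ⟨c, rfl⟩ := (Submodule.mem_span_range_iff_exists_fun R).1 hn
    refine ⟨fun i => c i • m, fun i => M.smul_mem _ hm, ?_⟩
    rw [Finset.mul_sum]
    exact Finset.sum_congr rfl fun i _ => by rw [mul_smul_comm, smul_mul_assoc]
  · rintro _ _ ⟨g, hg, rfl⟩ ⟨g', hg', rfl⟩
    exact ⟨fun i => g i + g' i, fun i => add_mem (hg i) (hg' i), by
      simp only [add_mul, Finset.sum_add_distrib]⟩

theorem exists_sum_add_sum_of_mem_sup {R A ι : Type*} [CommSemiring R] [CommSemiring A]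
    [Algebra R A] [Fintype ι] {M N : Submodule R A} {v w : ι → A} {z F : A} {k : ℕ}
    (hF : F ∈ M * Submodule.span R (Set.range v) ⊔
      Submodule.span R {z} ^ k * (N * Submodule.span R (Set.range w))) :
    ∃ g h : ι → A, (∀ i, g i ∈ M) ∧ (∀ i, h i ∈ N) ∧
      F = ∑ i, g i * v i + ∑ i, h i * (z ^ k * w i) := by
  rw [Submodule.span_pow, Set.singleton_pow] at hF
  obtain ⟨a, ha, b, hb, hab⟩ := Submodule.mem_sup.1 hF
  obtain ⟨c, hc, hcb⟩ := Submodule.mem_span_singleton_mul.1 hb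
  obtain ⟨g, hg, hga⟩ := exists_sum_of_mem_mul_span_range ha
  obtain ⟨h, hh, hhc⟩ := exists_sum_of_mem_mul_span_range hc
  refine ⟨g, h, hg, hh, ?_⟩
  rw [← hab, ← hcb, hga, hhc, Finset.mul_sum]
  simp only [mul_left_comm]

theorem X_two_sq_mul_homogeneousSubmodule_three_le :
    𝒵 * (𝒵 * 𝒮 3) ≤ 𝒮 1 * 𝒥 ⊔ 𝒮 1 * 𝒲 := by
  generalize hM : 𝒮 1 * 𝒥 ⊔ 𝒮 1 * 𝒲 = M
  have h : 𝒮 3 ≤ M.comap (LinearMap.mulLeft ℂ (X 2 ^ 2)) :=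
    homogeneousSubmodule_le_of_monomials fun a b c h => by
      obtain rfl : c = 3 - a - b := by omega
      rw [Submodule.mem_comap, LinearMap.mulLeft_apply, ← hM]
      exact X_two_sq_mul_cubic_mem (by omega)
  refine Submodule.mul_le.2 fun u hu v hv => ?_
  obtain ⟨c, hc⟩ := Submodule.mem_span_singleton.1 hu
  obtain ⟨w, hw, hwv⟩ := Submodule.mem_span_singleton_mul.1 hv
  rw [← hc, ← hwv, smul_mul_assoc, ← mul_assoc, ← sq]
  have hw' := h hw
  rw [Submodule.mem_comap, LinearMap.mulLeft_apply] at hw'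
  exact M.smul_mem c hw'

theorem starFormPartial_mul {R : Type*} [CommRing R] (l g : Fin 5 → R) (c : R) (i : Fin 5) :
    starFormPartial l (fun j => c * g j) i = c * starFormPartial l g i := by
  rw [starFormPartial, starFormPartial, Finset.mul_sum]
  simp only [mul_assoc]

/-- In every degree `k + 5`, the differential of `starForm` at the lines `baseLine` and the
multipliers `z ^ k * baseMultiplier` is onto the space of forms. -/
theorem exists_tangent_eq (k : ℕ) {F : MvPolynomial (Fin 3) ℂ} (hF : F.IsHomogeneous (k + 5)) :
    ∃ l' g' : Fin 5 → MvPolynomial (Fin 3) ℂ, (∀ i, (l' i).IsHomogeneous 1) ∧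
      (∀ i, (g' i).IsHomogeneous (k + 1)) ∧
      F = ∑ i, g' i * cofactor baseLine i +
        ∑ i, l' i * starFormPartial baseLine (fun j => X 2 ^ k * baseMultiplier j) i := by
  have hZ : 𝒵 ≤ 𝒮 1 :=
    (Submodule.span_singleton_le_iff_mem _ _).2 (X_mem_homogeneousSubmodule 2)
  have hmem : F ∈ 𝒮 (k + 5) := (mem_homogeneousSubmodule _ _).2 hF
  obtain ⟨g', l', hg', hl', h⟩ := exists_sum_add_sum_of_mem_sup
    (le_sup_pow_mul (S := homogeneousSubmodule (Fin 3) ℂ) (fun m n => homogeneousSubmodule_mul_eq rfl) hZ homogeneousSubmodule_four_le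
      X_two_sq_mul_homogeneousSubmodule_three_le k hmem)
  refine ⟨l', g', fun i => (mem_homogeneousSubmodule _ _).1 (hl' i),
    fun i => (mem_homogeneousSubmodule _ _).1 (hg' i), ?_⟩
  simp only [starFormPartial_mul]
  exact h

noncomputable instance MonomialIndex.instFintype (n : ℕ) : Fintype (MonomialIndex n) :=
  (Finsupp.finite_of_degree_eq n).fintype

/-! ### Forms with given coefficients -/

section FormOfCoeffs

variable {R : Type*} [CommRing R]

/-- The ternary form of degree `n` with the given coefficients. -/
noncomputable def formOfCoeffs (n : ℕ) (c : MonomialIndex n → R) : MvPolynomial (Fin 3) R :=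
  ∑ m, monomial m.1 (c m)

theorem coeff_formOfCoeffs {n : ℕ} (c : MonomialIndex n → R) (m : MonomialIndex n) :
    coeff m.1 (formOfCoeffs n c) = c m := by
  classical
  rw [formOfCoeffs, coeff_sum, Finset.sum_eq_single m]
  · simp
  · intro m' _ hne
    rw [coeff_monomial, if_neg (fun h => hne (Subtype.ext h))]
  · simp

theorem isHomogeneous_formOfCoeffs {n : ℕ} (c : MonomialIndex n → R) :
    (formOfCoeffs n c).IsHomogeneous n :=
  IsHomogeneous.sum _ _ _ fun m _ => isHomogeneous_monomial _ m.2

theorem eq_of_coeff_eq {n : ℕ} {F G : MvPolynomial (Fin 3) R} (hF : F.IsHomogeneous n)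
    (hG : G.IsHomogeneous n) (h : ∀ m : MonomialIndex n, coeff m.1 F = coeff m.1 G) : F = G := by
  ext m
  by_cases hm : m.degree = n
  · exact h ⟨m, hm⟩
  · rw [hF.coeff_eq_zero hm, hG.coeff_eq_zero hm]

theorem formOfCoeffs_coeff {n : ℕ} {F : MvPolynomial (Fin 3) R} (hF : F.IsHomogeneous n) :
    formOfCoeffs n (fun m => coeff m.1 F) = F :=
  eq_of_coeff_eq (isHomogeneous_formOfCoeffs _) hF fun m => coeff_formOfCoeffs _ m

theorem map_formOfCoeffs {S : Type*} [CommRing S] (φ : R →+* S) {n : ℕ} (c : MonomialIndex n → R) :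
    map φ (formOfCoeffs n c) = formOfCoeffs n (fun m => φ (c m)) := by
  simp [formOfCoeffs]

theorem formOfCoeffs_add_mul {n : ℕ} (t : R) (c c' : MonomialIndex n → R) :
    formOfCoeffs n (fun m => c m + t * c' m) =
      formOfCoeffs n c + C t * formOfCoeffs n c' := by
  simp [formOfCoeffs, Finset.mul_sum, C_mul_monomial, Finset.sum_add_distrib]

theorem coeff_single_sum_C_mul_X (c : Fin 3 → R) (s : Fin 3) :
    coeff (Finsupp.single s 1) (∑ i, C (c i) * X i) = c s := by
  classical
  have : ∀ i, (Finsupp.single i 1 = Finsupp.single s (1 : ℕ)) ↔ i = s := fun i =>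
    (Finsupp.single_left_injective one_ne_zero).eq_iff
  simp [coeff_sum, coeff_C_mul, coeff_X, this]

theorem eval_eq_sum_of_isHomogeneous_one {F : MvPolynomial (Fin 3) R} (hF : F.IsHomogeneous 1)
    (v : Fin 3 → R) : eval v F = ∑ s, coeff (Finsupp.single s 1) F * v s := by
  have hF' : F ∈ Submodule.span R (Set.range (X : Fin 3 → MvPolynomial (Fin 3) R)) := by
    rw [← homogeneousSubmodule_one_eq_span_X]
    exact (mem_homogeneousSubmodule _ _).2 hF
  obtain ⟨c, rfl⟩ := (Submodule.mem_span_range_iff_exists_fun R).1 hF'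
  simp only [smul_eq_C_mul, coeff_single_sum_C_mul_X]
  simp

end FormOfCoeffs

/-! ### The parametrization of the curves containing a star configuration -/

/-- Indices of the parameters of `starForm` in degree `k + 5`: for each `i : Fin 5`, the
coefficients of a linear form (the line) and of a form of degree `k + 1` (the multiplier). -/
abbrev StarParam (k : ℕ) : Type := Fin 5 × (MonomialIndex 1 ⊕ MonomialIndex (k + 1))

namespace StarParam

variable {R : Type*} [CommRing R] {k : ℕ}

/-- The `i`-th line of a parameter. -/
noncomputable def line (q : StarParam k → R) (i : Fin 5) : MvPolynomial (Fin 3) R :=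
  formOfCoeffs 1 fun m => q (i, Sum.inl m)

/-- The `i`-th multiplier of a parameter. -/
noncomputable def multiplier (q : StarParam k → R) (i : Fin 5) : MvPolynomial (Fin 3) R :=
  formOfCoeffs (k + 1) fun m => q (i, Sum.inr m)

/-- The form of degree `k + 5` of a parameter. For `q = X` this is the universal form, and its
coefficients are the components of the parametrization. -/
noncomputable def form (q : StarParam k → R) : MvPolynomial (Fin 3) R :=
  starForm (line q) (multiplier q)

/-- The matrix whose rows are the coefficients of the lines `t 0`, `t 1`, `t 2`. -/
noncomputable def lineMatrix (q : StarParam k → R) (t : Fin 3 → Fin 5) :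
    Matrix (Fin 3) (Fin 3) R :=
  Matrix.of fun r s => coeff (Finsupp.single s 1) (line q (t r))

/-- The product of the determinants of all triples of different lines (over injections, so each
triple occurs once for each of its orderings): it is nonzero if and only if no three lines are
concurrent. -/
noncomputable def nondegeneracy (q : StarParam k → R) : R :=
  ∏ t : Fin 3 ↪ Fin 5, (lineMatrix q t).det

theorem isHomogeneous_form (q : StarParam k → R) : (form q).IsHomogeneous (k + 5) := by
  refine IsHomogeneous.sum _ _ _ fun i _ => ?_
  have h4 : (cofactor (line q) i).IsHomogeneous 4 := by
    have h := IsHomogeneous.prod ({j | j ≠ i} : Finset (Fin 5)) (line q) (fun _ => 1)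
      fun j _ => isHomogeneous_formOfCoeffs _
    have hcard : ∑ j ∈ ({j | j ≠ i} : Finset (Fin 5)), 1 = 4 := by
      fin_cases i <;> rfl
    rwa [hcard] at h
  exact (isHomogeneous_formOfCoeffs (n := k + 1) _).mul h4

section map

variable {S : Type*} [CommRing S] (φ : R →+* S) (q : StarParam k → R)

theorem map_line (i : Fin 5) : map φ (line q i) = line (fun s => φ (q s)) i :=
  map_formOfCoeffs φ _

theorem map_form : map φ (form q) = form fun s => φ (q s) := by
  simp only [form, starForm, cofactor, map_sum, map_mul, map_prod, map_line]
  simp only [multiplier, map_formOfCoeffs]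

theorem map_nondegeneracy : φ (nondegeneracy q) = nondegeneracy fun s => φ (q s) := by
  rw [nondegeneracy, nondegeneracy, map_prod]
  refine Finset.prod_congr rfl fun t _ => ?_
  rw [RingHom.map_det]
  congr 1
  ext r s
  simp only [lineMatrix, RingHom.mapMatrix_apply, Matrix.map_apply, Matrix.of_apply, ← map_line,
    coeff_map]

end map

theorem aeval_coeff_form {A : Type*} [CommRing A] [Algebra R A] (q : StarParam k → A)
    (m : Fin 3 →₀ ℕ) :
    aeval q (coeff m (form (X : StarParam k → MvPolynomial (StarParam k) R))) =
      coeff m (form q) := by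
  have h := congrArg (coeff m) (map_form (aeval q : MvPolynomial (StarParam k) R →ₐ[R] A).toRingHom
    (X : StarParam k → MvPolynomial (StarParam k) R))
  simpa [coeff_map] using h

/-- The parameter with lines `baseLine` and multipliers `z ^ k * baseMultiplier`. -/
noncomputable def base (k : ℕ) : StarParam k → ℂ
  | (i, Sum.inl m) => coeff m.1 (baseLine i)
  | (i, Sum.inr m) => coeff m.1 (X 2 ^ k * baseMultiplier i)

theorem isHomogeneous_baseLine (i : Fin 5) : (baseLine i).IsHomogeneous 1 := by
  have h : ∀ (a : ℂ) (j : Fin 3), (C a * X j : MvPolynomial (Fin 3) ℂ).IsHomogeneous 1 :=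
    fun a j => isHomogeneous_C_mul_X a j
  have hX := isHomogeneous_X ℂ (σ := Fin 3)
  fin_cases i
  · exact hX 0
  · exact ((hX 0).add (hX 1)).add (hX 2)
  · exact ((hX 0).sub (hX 1)).add (hX 2)
  · exact ((hX 0).add (h 2 1)).add (h 4 2)
  · exact ((hX 0).sub (h 2 1)).add (h 4 2)

theorem isHomogeneous_baseMultiplier (i : Fin 5) : (baseMultiplier i).IsHomogeneous 1 := by
  fin_cases i <;> exact isHomogeneous_X _ _

theorem line_base (i : Fin 5) : line (base k) i = baseLine i :=
  formOfCoeffs_coeff (isHomogeneous_baseLine i)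

theorem multiplier_base (i : Fin 5) : multiplier (base k) i = X 2 ^ k * baseMultiplier i := by
  refine formOfCoeffs_coeff ?_
  simpa using (isHomogeneous_X_pow (R := ℂ) (2 : Fin 3) k).mul (isHomogeneous_baseMultiplier i)

theorem nondegeneracy_base : nondegeneracy (base k) ≠ 0 := by
  refine Finset.prod_ne_zero_iff.2 fun t _ => ?_
  let a : Fin 5 → ℂ := ![0, 1, -1, 2, -2]
  have ha : Function.Injective a := by
    intro i j h
    fin_cases i <;> fin_cases j <;> first | rfl | (exfalso; revert h; norm_num [a])
  have hM : lineMatrix (base k) t = Matrix.vandermonde (a ∘ t) := by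
    have hline : ∀ i, baseLine i = ∑ s : Fin 3, C (a i ^ (s : ℕ)) * X s := by
      intro i
      have h2 : (C 2 : MvPolynomial (Fin 3) ℂ) = 2 := map_ofNat C 2
      fin_cases i <;> norm_num [baseLine, a, Fin.sum_univ_three, h2] <;> ring
    ext r s
    rw [lineMatrix, Matrix.of_apply, line_base, hline, coeff_single_sum_C_mul_X]
    rfl
  rw [hM]
  exact Matrix.det_vandermonde_ne_zero_iff.2 (ha.comp t.injective)

/-- The parametrization `q ↦ form q` is dominant. -/
theorem aeval_injective (k : ℕ) : Function.Injective
    (aeval fun m : MonomialIndex (k + 5) =>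
      coeff m.1 (form (X : StarParam k → MvPolynomial (StarParam k) ℂ)) :
      MvPolynomial (MonomialIndex (k + 5)) ℂ →ₐ[ℂ] MvPolynomial (StarParam k) ℂ) := by
  refine aeval_injective_of_surjective_differential _ (base k)
    (fun m => coeff m.1 (form (base k))) fun w => ?_
  obtain ⟨l', g', hl', hg', hw⟩ := exists_tangent_eq k (isHomogeneous_formOfCoeffs w)
  let v : StarParam k → ℂ := fun s => match s with
    | (i, Sum.inl m) => coeff m.1 (l' i)
    | (i, Sum.inr m) => coeff m.1 (g' i)
  have hvl : line v = l' := funext fun i => formOfCoeffs_coeff (hl' i)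
  have hvg : multiplier v = g' := funext fun i => formOfCoeffs_coeff (hg' i)
  refine ⟨v, fun m => ?_⟩
  -- expand the form of the parameter `base k + X * v` over `ℂ[X]` to first order in `X`
  let ι := map (σ := Fin 3) (Polynomial.C (R := ℂ))
  obtain ⟨r, hr⟩ := exists_starForm_add_mul (C Polynomial.X)
    (fun i => ι (line (base k) i)) (fun i => ι (multiplier (base k) i))
    (fun i => ι (l' i)) (fun i => ι (g' i))
  refine ⟨coeff m.1 r, ?_⟩
  have hform : form (fun t => Polynomial.C (base k t) + Polynomial.X * Polynomial.C (v t)) =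
      ι (form (base k)) + C Polynomial.X * ι (formOfCoeffs _ w) + C Polynomial.X ^ 2 * r := by
    have h1 : ι (form (base k)) =
        starForm (fun i => ι (line (base k) i)) (fun i => ι (multiplier (base k) i)) := by
      simp [form, starForm, cofactor, map_sum, map_mul, map_prod]
    have h2 : ι (formOfCoeffs _ w) = ∑ i, ι (g' i) * cofactor (fun i => ι (line (base k) i)) i +
        ∑ i, ι (l' i) * starFormPartial (fun i => ι (line (base k) i))
          (fun i => ι (multiplier (base k) i)) i := by
      rw [hw]
      simp only [starFormPartial, cofactor, map_add, map_sum, map_mul, map_prod, line_base,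
        multiplier_base]
    rw [h1, h2, ← hr, form]
    congr 1
    · funext i
      rw [line, formOfCoeffs_add_mul, ← map_formOfCoeffs, ← map_formOfCoeffs, ← hvl]
      rfl
    · funext i
      rw [multiplier, formOfCoeffs_add_mul, ← map_formOfCoeffs, ← map_formOfCoeffs, ← hvg]
      rfl
  rw [aeval_coeff_form, hform, ← C_pow]
  simp only [coeff_add, coeff_C_mul, ι, coeff_map, coeff_formOfCoeffs]

end StarParam

/-! ### Genericity -/

/-- A nonempty open subset of affine space meets the punctured line through `0` and every point of
some nonempty open cone: take for `G` a nonzero homogeneous component of `a`. -/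
theorem exists_isHomogeneous_eval_ne_zero {σ : Type*} {a : MvPolynomial σ ℂ} (ha : a ≠ 0) :
    ∃ (n : ℕ) (G : MvPolynomial σ ℂ), G ≠ 0 ∧ G.IsHomogeneous n ∧
      ∀ x, eval x G ≠ 0 → ∃ c : ℂ, c ≠ 0 ∧ eval (fun s => c * x s) a ≠ 0 := by
  obtain ⟨n, hn⟩ : ∃ n, homogeneousComponent n a ≠ 0 := by
    by_contra! hall
    exact ha (by rw [← sum_homogeneousComponent a]; simp [hall])
  refine ⟨n, _, hn, homogeneousComponent_isHomogeneous n a, fun x hx => ?_⟩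
  let Q : Polynomial ℂ := ∑ i ∈ Finset.range (a.totalDegree + 1),
    Polynomial.C (eval x (homogeneousComponent i a)) * Polynomial.X ^ i
  have hQ : Q ≠ 0 := by
    intro h0
    have hcoeff : Q.coeff n = 0 := by rw [h0, Polynomial.coeff_zero]
    have hmem : n < a.totalDegree + 1 := by
      by_contra hnot
      exact hn (homogeneousComponent_eq_zero _ _ (by omega))
    simp only [Q, Polynomial.finsetSum_coeff, Polynomial.coeff_C_mul_X_pow] at hcoeff
    rw [Finset.sum_eq_single n (by intro i _ hi; simp [hi.symm]) (by simp; omega)] at hcoeff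
    exact hx (by simpa using hcoeff)
  -- the factor `X` ensures that the scalar `c` is nonzero
  obtain ⟨c, hc⟩ : ∃ c, (Polynomial.X * Q).eval c ≠ 0 := by
    by_contra! hall
    exact mul_ne_zero Polynomial.X_ne_zero hQ (Polynomial.funext fun c => by simpa using hall c)
  rw [Polynomial.eval_mul, Polynomial.eval_X] at hc
  refine ⟨c, left_ne_zero_of_mul hc, ?_⟩
  have heval : eval (fun s => c * x s) a = Q.eval c := by
    conv_lhs => rw [← sum_homogeneousComponent a, map_sum]
    simp only [Q, Polynomial.eval_finsetSum, Polynomial.eval_mul, Polynomial.eval_C,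
      Polynomial.eval_pow, Polynomial.eval_X]
    refine Finset.sum_congr rfl fun i _ => ?_
    have := aeval_mul_of_isHomogeneous (homogeneousComponent_isHomogeneous i a) c x
    rw [aeval_eq_eval, aeval_eq_eval] at this
    exact this.trans (mul_comm _ _)
  rw [heval]
  exact right_ne_zero_of_mul hc

/-- A curve in the image of a nondegenerate parameter contains the star configuration of its
lines: at the intersection of two lines every cofactor vanishes. -/
theorem exists_starConfiguration_subset {k : ℕ} (q : StarParam k → ℂ)
    (hq : StarParam.nondegeneracy q ≠ 0) (C : PlaneCurve (k + 5)) {c : ℂ} (hc : c ≠ 0)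
    (hC : StarParam.form q = c • C.equation) :
    ∃ X : Set ProjPlane, IsStarConfiguration 5 X ∧ X ⊆ C.points := by
  have hdet : ∀ t : Fin 3 ↪ Fin 5, (StarParam.lineMatrix q t).det ≠ 0 := fun t =>
    Finset.prod_ne_zero_iff.1 hq t (Finset.mem_univ t)
  have hline : ∀ i, (StarParam.line q i).IsHomogeneous 1 := fun i => isHomogeneous_formOfCoeffs _
  have htriple : ∀ i j m : Fin 5, i ≠ j → i ≠ m → j ≠ m → ∃ t : Fin 3 ↪ Fin 5,
      t 0 = i ∧ t 1 = j ∧ t 2 = m := by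
    intro i j m hij him hjm
    refine ⟨⟨![i, j, m], ?_⟩, rfl, rfl, rfl⟩
    intro a b hab
    fin_cases a <;> fin_cases b <;> simp_all
  have hne : ∀ i, StarParam.line q i ≠ 0 := by
    intro i h0
    obtain ⟨j, m, hij, him, hjm⟩ : ∃ j m : Fin 5, i ≠ j ∧ i ≠ m ∧ j ≠ m := by
      clear * -
      revert i
      decide
    obtain ⟨t, ht, -, -⟩ := htriple i j m hij him hjm
    refine hdet t (Matrix.det_eq_zero_of_row_eq_zero 0 fun s => ?_)
    simp [StarParam.lineMatrix, ht, h0]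
  let F : Fin 5 → homogeneousSubmodule (Fin 3) ℂ 1 := fun i =>
    ⟨StarParam.line q i, (mem_homogeneousSubmodule _ _).2 (hline i)⟩
  have hF : ∀ i, F i ≠ 0 := fun i h => hne i (congrArg Subtype.val h)
  let L : Fin 5 → PlaneCurve 1 := fun i => Projectivization.mk ℂ (F i) (hF i)
  have hL : ∀ i (p : ProjPlane), p ∈ (L i).points ↔ eval p.rep (StarParam.line q i) = 0 := by
    intro i p
    conv_lhs => rw [← p.mk_rep]
    exact PlaneCurve.mk_mem_points_iff (F i) (hF i) p.rep p.rep_nonzero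
  refine ⟨_, ⟨L, ?_, ?_, rfl⟩, ?_⟩
  · intro i j hij
    by_contra hne'
    obtain ⟨m, him, hjm⟩ : ∃ m : Fin 5, i ≠ m ∧ j ≠ m := by
      clear * -
      revert i j
      decide
    obtain ⟨t, hti, htj, -⟩ := htriple i j m hne' him hjm
    obtain ⟨a, ha⟩ := (Projectivization.mk_eq_mk_iff' ℂ _ _ (hF i) (hF j)).1 hij
    have ha' : a • StarParam.line q j = StarParam.line q i := congrArg Subtype.val ha
    refine hdet t (Matrix.exists_vecMul_eq_zero_iff.1 ⟨![1, -a, 0], ?_, ?_⟩)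
    · intro h
      simpa using congrFun h 0
    · funext s
      simp [Matrix.vecMul, dotProduct, Fin.sum_univ_three, StarParam.lineMatrix, hti, htj, ← ha']
  · intro i j m hij him hjm
    obtain ⟨t, hti, htj, htm⟩ := htriple i j m hij him hjm
    refine Set.eq_empty_of_forall_notMem fun p hp => ?_
    obtain ⟨⟨hpi, hpj⟩, hpm⟩ := hp
    rw [hL, eval_eq_sum_of_isHomogeneous_one (hline _)] at hpi hpj hpm
    refine hdet t (Matrix.exists_mulVec_eq_zero_iff.1 ⟨p.rep, p.rep_nonzero, ?_⟩)
    funext r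
    fin_cases r
    · simpa [Matrix.mulVec, dotProduct, StarParam.lineMatrix, hti] using hpi
    · simpa [Matrix.mulVec, dotProduct, StarParam.lineMatrix, htj] using hpj
    · simpa [Matrix.mulVec, dotProduct, StarParam.lineMatrix, htm] using hpm
  · rintro p ⟨i, j, hij, hpi, hpj⟩
    rw [hL] at hpi hpj
    have h0 : eval p.rep (StarParam.form q) = 0 := by
      rw [StarParam.form, starForm, map_sum]
      refine Finset.sum_eq_zero fun m _ => ?_
      rw [map_mul, cofactor, map_prod]
      by_cases hm : i = m
      · rw [Finset.prod_eq_zero (i := j) (by simp; omega) hpj, mul_zero]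
      · rw [Finset.prod_eq_zero (i := i) (by simpa using hm) hpi, mul_zero]
    rw [hC, smul_eval] at h0
    exact (mul_eq_zero.1 h0).resolve_left hc

theorem theorem6p2 (d : ℕ) (hd : 4 < d) :
    GenericPlaneCurve d (fun C => ∃ X : Set ProjPlane, IsStarConfiguration 5 X ∧ X ⊆ C.points) := by
  obtain ⟨k, rfl⟩ : ∃ k, d = k + 5 := ⟨d - 5, by omega⟩
  have hb : StarParam.nondegeneracy (X : StarParam k → MvPolynomial (StarParam k) ℂ) ≠ 0 := by
    intro h
    apply StarParam.nondegeneracy_base (k := k)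
    have := StarParam.map_nondegeneracy (eval (StarParam.base k))
      (X : StarParam k → MvPolynomial (StarParam k) ℂ)
    simpa [h] using this.symm
  obtain ⟨a, ha, hlift⟩ := exists_ne_zero_forall_mem_range _ (StarParam.aeval_injective k) hb
  obtain ⟨n, G, hG, hGn, hscale⟩ := exists_isHomogeneous_eval_ne_zero ha
  -- `a` need not be homogeneous, but containing a star configuration is invariant under scaling
  refine ⟨{C | eval C.coords G ≠ 0}, ⟨{G}, ?_, ?_⟩, ?_, ?_⟩
  · rintro _ rfl
    exact ⟨n, hGn⟩
  · ext C
    simp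
  -- the factor `X m₀` makes the form with coefficients `x` nonzero, even if `G` is constant
  · let m₀ : MonomialIndex (k + 5) := ⟨Finsupp.single 0 (k + 5), by simp⟩
    obtain ⟨x, hx⟩ : ∃ x, eval x (X m₀ * G) ≠ 0 := by
      by_contra! hall
      exact mul_ne_zero (X_ne_zero m₀) hG (MvPolynomial.funext fun x => by simpa using hall x)
    rw [map_mul, eval_X] at hx
    let F : homogeneousSubmodule (Fin 3) ℂ (k + 5) :=
      ⟨formOfCoeffs _ x, (mem_homogeneousSubmodule _ _).2 (isHomogeneous_formOfCoeffs x)⟩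
    have hF : F ≠ 0 := by
      intro h
      have h' : formOfCoeffs _ x = 0 := congrArg Subtype.val h
      apply left_ne_zero_of_mul hx
      rw [← coeff_formOfCoeffs x m₀, h', coeff_zero]
    refine ⟨Projectivization.mk ℂ F hF, ?_⟩
    obtain ⟨u, hu⟩ := Projectivization.exists_smul_eq_mk_rep ℂ F hF
    have hcoords : PlaneCurve.coords (Projectivization.mk ℂ F hF) =
        fun m => (u : ℂ) * x m := by
      funext m
      rw [PlaneCurve.coords, PlaneCurve.equation, ← hu, Units.smul_def, Submodule.coe_smul,
        coeff_smul, smul_eq_mul, coeff_formOfCoeffs]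
    have := aeval_mul_of_isHomogeneous hGn (u : ℂ) x
    rw [aeval_eq_eval, aeval_eq_eval] at this
    change eval _ G ≠ 0
    rw [hcoords]
    exact this ▸ mul_ne_zero (pow_ne_zero _ u.ne_zero) (right_ne_zero_of_mul hx)
  · intro C hC
    obtain ⟨c, hc, hca⟩ := hscale _ hC
    obtain ⟨q, hq, hqC⟩ := hlift _ hca
    have hq' : StarParam.nondegeneracy q ≠ 0 := by
      rw [StarParam.map_nondegeneracy] at hq
      simpa using hq
    refine exists_starConfiguration_subset q hq' C hc ?_
    have hCeq : C.equation.IsHomogeneous (k + 5) :=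
      (mem_homogeneousSubmodule _ _).1 (C.rep : homogeneousSubmodule (Fin 3) ℂ (k + 5)).2
    refine eq_of_coeff_eq (StarParam.isHomogeneous_form q) ?_ fun m => ?_
    · rw [smul_eq_C_mul]
      exact hCeq.C_mul c
    · have := hqC m
      rw [← aeval_eq_eval, StarParam.aeval_coeff_form] at this
      rw [this, coeff_smul, smul_eq_mul]
      rfl
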